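/- Let $B_4=\langle \sigma_1,\sigma_2,\sigma_3 \mid \sigma_1\sigma_2\sigma_1=\sigma_2\sigma_1\sigma_2,\ \sigma_2\sigma_3\sigma_2=\sigma_3\sigma_2\sigma_3,\ \sigma_1\sigma_3=\sigma_3\sigma_1\rangle$ be the braid group on four strands and let $\delta=\sigma_1\sigma_2\sigma_3$. The Brady complex $X$ is the following polygonal 2-complex. Its vertices are the left cosets $g\langle\delta\rangle$, $g\in B_4$; its edges join $g\langle\delta\rangle$ to $g\sigma_i\langle\delta\rangle$ for $g\in B_4$ and $i\in\{1,2,3\}$; and its faces are, for $g\in B_4$, * the triangles with vertices $g\langle\delta\rangle,\ g\sigma_1\langle\delta\rangle,\ g\sigma_1\sigma_2\langle\delta\rangle$, and * the lozenges with successive vertices $g\langle\delta\rangle,\ g\sigma_1\langle\delta\rangle,\ g\sigma_1\sigma_3\langle\delta\rangle,\ g\sigma_3\langle\delta\rangle$, where faces with the same boundary circuit are the same face. (With equilateral triangles of side one, and lozenges of side one with angle $2\pi/3$ at $g\langle\delta\rangle$ and at $g\sigma_1\sigma_3\langle\delta\rangle$, this is the CAT(0) 2-complex on which $\mathrm{Aut}(F_2)$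 acts geometrically; the quotient of $B_4$ by its centre $\langle\delta^4\rangle$ is a subgroup of index two in $\mathrm{Aut}(F_2)$ and acts by left multiplication.) A *Hamiltonian surface* in a 2-complex is a subcomplex which is a connected surface without boundary (it is connected, each of its edges lies in exactly two of its faces, and the link in it of each of its vertices is a single circle) and which contains every vertex and every edge of the 2-complex. Thus it passes exactly once through every edge and every vertex, and has no multiple vertices. **Theorem.** The Brady complex $X$ contains precisely two Hamiltonian surfaces. -/

import Mathlib

/-! ### Polygonal 2-complexes and surfaces inside them -/

/-- A (combinatorial) polygonal 2-complex with vertex set `V`: its 1-skeleton is a simple graph, and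
every face is a polygon glued along an embedded circuit of the 1-skeleton. Distinct faces have
distinct boundary circuits, so a face is recorded by the set of its boundary edges. -/
structure PolygonalComplex (V : Type*) where
  skeleton : SimpleGraph V
  faces : Set (Set (Sym2 V))
  boundary_isCycle : ∀ f ∈ faces, ∃ (v : V) (c : skeleton.Walk v v),
    c.IsCycle ∧ f = {e | e ∈ c.edges}

namespace PolygonalComplex

variable {V : Type*}

/-- A subcomplex: a subgraph of the 1-skeleton together with a set of faces whose boundary edges all
lie in that subgraph. -/
structure Subcomplex (X : PolygonalComplex V) where
  skeleton : X.skeleton.Subgraph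
  faces : Set (Set (Sym2 V))
  faces_subset : faces ⊆ X.faces
  boundary_subset : ∀ f ∈ faces, f ⊆ skeleton.edgeSet

namespace Subcomplex

variable {X : PolygonalComplex V}

/-- The edges of the subcomplex `K` that are incident to `v`, that is, the vertices of the link of
`v` in `K`. -/
def edgesAt (K : Subcomplex X) (v : V) : Set (Sym2 V) :=
  {e | e ∈ K.skeleton.edgeSet ∧ v ∈ e}

/-- The link of `v` in the subcomplex `K`: two edges at `v` are adjacent if they bound a common face
of `K`. (Possible parallel edges of the link are identified here; they are accounted for by
`IsSurface.two_faces`.) -/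
def link (K : Subcomplex X) (v : V) : SimpleGraph (K.edgesAt v) where
  Adj e e' := e ≠ e' ∧ ∃ f ∈ K.faces, (e : Sym2 V) ∈ f ∧ (e' : Sym2 V) ∈ f
  symm := ⟨fun _ _ ⟨hne, f, hf, h, h'⟩ => ⟨hne.symm, f, hf, h', h⟩⟩
  loopless := ⟨fun _ h => h.1 rfl⟩

/-- The subcomplex `K` is a connected surface without boundary: it is connected, every edge of `K`
lies in exactly two faces of `K`, and the link of every vertex of `K` is a circle. The corners at
`v` of the faces of `K` are the edges of the link of `v`, so `two_faces` says that all vertices of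
the link have degree two, and such a graph is a circle exactly when it is finite and connected. -/
structure IsSurface (K : Subcomplex X) : Prop where
  connected : K.skeleton.Connected
  two_faces : ∀ e ∈ K.skeleton.edgeSet, {f | f ∈ K.faces ∧ e ∈ f}.encard = 2
  link_finite : ∀ v ∈ K.skeleton.verts, (K.edgesAt v).Finite
  link_connected : ∀ v ∈ K.skeleton.verts, (K.link v).Connected

/-- A Hamiltonian surface of `X`: an embedded connected surface without boundary which visits every
vertex and every edge of `X`. Being a subcomplex it runs only once through each edge, and since the
link of each of its vertices is a single circle it has no multiple vertex. -/
structure IsHamiltonianSurface (K : Subcomplex X) : Prop where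
  isSurface : K.IsSurface
  every_vertex : ∀ v : V, v ∈ K.skeleton.verts
  every_edge : ∀ e ∈ X.skeleton.edgeSet, e ∈ K.skeleton.edgeSet

end Subcomplex

end PolygonalComplex

/-! ### The braid group on four strands -/

/-- The Artin relators of the braid group on four strands, with generators `σ₁, σ₂, σ₃` indexed by
`0, 1, 2`. -/
def braidRels : Set (FreeGroup (Fin 3)) :=
  let s : Fin 3 → FreeGroup (Fin 3) := FreeGroup.of
  {s 0 * s 1 * s 0 * (s 1 * s 0 * s 1)⁻¹,
   s 1 * s 2 * s 1 * (s 2 * s 1 * s 2)⁻¹,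
   s 0 * s 2 * (s 2 * s 0)⁻¹}

/-- The braid group `B₄` on four strands. -/
abbrev Braid4 : Type := PresentedGroup braidRels

namespace Braid4

/-- The standard generators `σ₁, σ₂, σ₃` (indexed by `0, 1, 2`). -/
def σ (i : Fin 3) : Braid4 := PresentedGroup.of i

/-- The dual Garside element `δ = σ₁σ₂σ₃`; its fourth power generates the centre of `B₄`. -/
def δ : Braid4 := σ 0 * σ 1 * σ 2

end Braid4

/-! ### The Brady complex -/

namespace Brady

open Braid4

/-- The vertices of the Brady complex: the left cosets `g⟨δ⟩` in `B₄`. -/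
abbrev Vertex : Type := Braid4 ⧸ Subgroup.zpowers δ

/-- The vertex `g⟨δ⟩`. -/
def vert (g : Braid4) : Vertex := (g : Braid4 ⧸ Subgroup.zpowers δ)

/-- The 1-skeleton: an edge joins `g⟨δ⟩` to `gσᵢ⟨δ⟩`, for all `g` and `i`. -/
def skeleton : SimpleGraph Vertex :=
  SimpleGraph.fromEdgeSet {e | ∃ (g : Braid4) (i : Fin 3), e = s(vert g, vert (g * σ i))}

/-- The boundary of the triangle with vertices `g⟨δ⟩`, `gσ₁⟨δ⟩`, `gσ₁σ₂⟨δ⟩`; its sides are the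
edges labelled by the successive letters of `δ = σ₁σ₂σ₃`. -/
def triangle (g : Braid4) : Set (Sym2 Vertex) :=
  {s(vert g, vert (g * σ 0)),
   s(vert (g * σ 0), vert (g * σ 0 * σ 1)),
   s(vert (g * σ 0 * σ 1), vert g)}

/-- The boundary of the lozenge with successive vertices `g⟨δ⟩`, `gσ₁⟨δ⟩`, `gσ₁σ₃⟨δ⟩`, `gσ₃⟨δ⟩`,
which comes from the relation `σ₁σ₃ = σ₃σ₁`. In the metric of the Brady complex, in which all edges
have length one, its angle is `2π/3` at the first and third of them, and `π/3` at the others. -/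
def lozenge (g : Braid4) : Set (Sym2 Vertex) :=
  {s(vert g, vert (g * σ 0)),
   s(vert (g * σ 0), vert (g * σ 0 * σ 2)),
   s(vert (g * σ 0 * σ 2), vert (g * σ 2)),
   s(vert (g * σ 2), vert g)}

/-- The action of a braid on its four end points. -/
def perm : Braid4 →* Equiv.Perm (Fin 4) :=
  PresentedGroup.toGroup (f := fun i : Fin 3 => Equiv.swap i.castSucc i.succ) (by
    intro r hr
    simp only [braidRels, Set.mem_insert_iff, Set.mem_singleton_iff] at hr
    rcases hr with rfl | rfl | rfl <;>
      simp only [map_mul, map_inv, FreeGroup.lift_apply_of] <;> decide)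

theorem perm_σ (i : Fin 3) : perm (σ i) = Equiv.swap i.castSucc i.succ :=
  PresentedGroup.toGroup.of _

/-- Cosets are distinguished by the action on the end points. -/
theorem vert_ne {g h : Braid4}
    (H : perm (g⁻¹ * h) * perm δ ≠ perm δ * perm (g⁻¹ * h)) : vert g ≠ vert h := by
  intro e
  have hm : g⁻¹ * h ∈ Subgroup.zpowers δ := QuotientGroup.eq.1 e
  obtain ⟨k, hk⟩ := Subgroup.mem_zpowers_iff.1 hm
  apply H
  rw [← hk, ← map_mul, ← map_mul, (Commute.refl δ).zpow_left k]

theorem vert_mul_δ (g : Braid4) : vert (g * δ) = vert g := by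
  refine (QuotientGroup.eq.2 ?_).symm
  simp [Subgroup.mem_zpowers]

theorem σ_comm : σ 0 * σ 2 = σ 2 * σ 0 := by
  have h : (PresentedGroup.mk braidRels)
      (FreeGroup.of 0 * FreeGroup.of 2 * (FreeGroup.of 2 * FreeGroup.of 0)⁻¹) = 1 :=
    PresentedGroup.one_of_mem (by simp [braidRels])
  rw [map_mul, map_inv, mul_inv_eq_one, map_mul, map_mul] at h
  exact h

theorem adj {g h : Braid4} (i : Fin 3) (e : vert h = vert (g * σ i)) :
    skeleton.Adj (vert g) (vert h) := by
  rw [e, skeleton, SimpleGraph.fromEdgeSet_adj]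
  refine ⟨⟨g, i, rfl⟩, vert_ne ?_⟩
  rw [inv_mul_cancel_left]
  simp only [δ, map_mul, perm_σ]
  fin_cases i <;> decide

/-- The Brady complex, a 2-complex made of triangles and lozenges. -/
def complex : PolygonalComplex Vertex where
  skeleton := skeleton
  faces := {f | ∃ g : Braid4, f = triangle g ∨ f = lozenge g}
  boundary_isCycle := by
    rintro f ⟨g, rfl | rfl⟩
    · have h1 : skeleton.Adj (vert g) (vert (g * σ 0)) := adj 0 rfl
      have h2 : skeleton.Adj (vert (g * σ 0)) (vert (g * σ 0 * σ 1)) := adj 1 rfl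
      have h3 : skeleton.Adj (vert (g * σ 0 * σ 1)) (vert g) :=
        adj 2 (by rw [← vert_mul_δ g, δ]; simp only [mul_assoc])
      refine ⟨_, .cons h1 (.cons h2 (.cons h3 .nil)), ?_, ?_⟩
      · have := h1.ne; have := h2.ne; have := h3.ne
        simp [SimpleGraph.Walk.cons_isCycle_iff]
        grind
      · ext e; simp [triangle]
    · have h1 : skeleton.Adj (vert g) (vert (g * σ 0)) := adj 0 rfl
      have h2 : skeleton.Adj (vert (g * σ 0)) (vert (g * σ 0 * σ 2)) := adj 2 rfl
      have h3 : skeleton.Adj (vert (g * σ 0 * σ 2)) (vert (g * σ 2)) :=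
        (adj 0 (by rw [mul_assoc, σ_comm, mul_assoc])).symm
      have h4 : skeleton.Adj (vert (g * σ 2)) (vert g) := (adj 2 rfl).symm
      have h5 : vert g ≠ vert (g * σ 0 * σ 2) := vert_ne (by
        rw [mul_assoc, inv_mul_cancel_left]
        simp only [δ, map_mul, perm_σ]
        decide)
      have h6 : vert (g * σ 0) ≠ vert (g * σ 2) := vert_ne (by
        rw [mul_inv_rev, mul_assoc, inv_mul_cancel_left]
        simp only [δ, map_mul, map_inv, perm_σ]
        decide)
      refine ⟨_, .cons h1 (.cons h2 (.cons h3 (.cons h4 .nil))), ?_, ?_⟩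
      · have := h1.ne; have := h2.ne; have := h3.ne; have := h4.ne
        simp [SimpleGraph.Walk.cons_isCycle_iff]
        grind
      · ext e; simp [lozenge]

end Brady

/-!
The edges of the Brady complex are `edge g`, from `g⟨δ⟩` to `gσ₁⟨δ⟩`, and `edge g = edge h` exactly
when `g` and `h` agree modulo the centre `⟨δ⁴⟩` (`edge_eq_iff`). Three faces contain `edge g`, namely
`triangle g`, `lozenge g` and `lozenge (g * (σ 2)⁻¹)` (`eq_of_edge_mem`). As `δ⁴` is a pure braid,
different edges of a face, different edges at a vertex and different faces on an edge are told apart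
by permutations in `S₄`, so these finite checks are decidable.

The link of a vertex is the Möbius ladder on eight vertices, and a Hamiltonian surface has to choose
a Hamiltonian cycle in each link: it omits a perfect matching of corners (`two_of_three`) whose
complement is connected (`exists_triangle_mem`, `exists_lozenge_mem`). Of the five Hamiltonian
cycles, three are impossible because the choices at neighbouring vertices have to agree
(`lozenge_mem_or`). In the other two every triangle is present, and the presence of `lozenge g`
changes when `g` is multiplied by `δ` or by `σ₁`. These two elements generate `B₄`, so `lozenge g` is
present exactly for the `g` of one given sign (`lozenge_mem_iff`).

Conversely, `sign_eq_of_lozenge_eq` says that the sign is a well-defined function of a lozenge, and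
`lozenge g` and `lozenge (g * (σ 2)⁻¹)` have opposite signs. So for each sign `ε` all triangles and
the lozenges of sign `ε` form a subcomplex `surface ε` with two faces on each edge, and its links are
circles (`surface_link_connected`).
-/

/-! ### The braid group -/

namespace Braid4

theorem σ_braid_zero : σ 0 * σ 1 * σ 0 = σ 1 * σ 0 * σ 1 := by
  have h : (PresentedGroup.mk braidRels)
      (FreeGroup.of 0 * FreeGroup.of 1 * FreeGroup.of 0 *
        (FreeGroup.of 1 * FreeGroup.of 0 * FreeGroup.of 1)⁻¹) = 1 :=
    PresentedGroup.one_of_mem (by simp [braidRels])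
  rw [map_mul, map_inv, mul_inv_eq_one] at h
  simp only [map_mul] at h
  exact h

theorem σ_braid_one : σ 1 * σ 2 * σ 1 = σ 2 * σ 1 * σ 2 := by
  have h : (PresentedGroup.mk braidRels)
      (FreeGroup.of 1 * FreeGroup.of 2 * FreeGroup.of 1 *
        (FreeGroup.of 2 * FreeGroup.of 1 * FreeGroup.of 2)⁻¹) = 1 :=
    PresentedGroup.one_of_mem (by simp [braidRels])
  rw [map_mul, map_inv, mul_inv_eq_one] at h
  simp only [map_mul] at h
  exact h

theorem δ_mul_σ_zero : δ * σ 0 = σ 1 * δ := by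
  calc δ * σ 0 = σ 0 * σ 1 * (σ 2 * σ 0) := by simp only [δ, mul_assoc]
    _ = σ 0 * σ 1 * σ 0 * σ 2 := by rw [← Brady.σ_comm]; simp only [mul_assoc]
    _ = σ 1 * δ := by rw [σ_braid_zero]; simp only [δ, mul_assoc]

theorem δ_mul_σ_one : δ * σ 1 = σ 2 * δ := by
  calc δ * σ 1 = σ 0 * (σ 1 * σ 2 * σ 1) := by simp only [δ, mul_assoc]
    _ = σ 0 * σ 2 * σ 1 * σ 2 := by rw [σ_braid_one]; simp only [mul_assoc]
    _ = σ 2 * δ := by rw [Brady.σ_comm]; simp only [δ, mul_assoc]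

theorem δ_sq_mul_σ_zero : δ ^ 2 * σ 0 = σ 2 * δ ^ 2 := by
  rw [pow_two, mul_assoc, δ_mul_σ_zero, ← mul_assoc, δ_mul_σ_one, mul_assoc]

theorem σ_zero_mul_δ_pow_three : (σ 0 * δ) ^ 3 = δ ^ 4 := by
  calc (σ 0 * δ) ^ 3 = σ 0 * (δ * σ 0) * (δ * σ 0) * δ := by
        simp only [pow_succ, pow_zero, one_mul, mul_assoc]
    _ = σ 0 * σ 1 * (δ * σ 1) * δ ^ 2 := by
        rw [δ_mul_σ_zero]; simp only [pow_succ, pow_zero, one_mul, mul_assoc]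
    _ = δ ^ 4 := by
        rw [δ_mul_σ_one, ← mul_assoc, ← δ]
        simp only [pow_succ, pow_zero, one_mul, mul_assoc]

theorem σ_zero_comm_δ_pow_four : σ 0 * δ ^ 4 = δ ^ 4 * σ 0 := by
  have h : Commute (σ 0 * δ) (δ ^ 4) := by
    rw [← σ_zero_mul_δ_pow_three]; exact Commute.self_pow _ _
  have h' : Commute (σ 0 * δ * δ⁻¹) (δ ^ 4) := h.mul_left ((Commute.self_pow δ 4).inv_left)
  rwa [mul_inv_cancel_right] at h'

theorem δ_sq_mul_σ_two : δ ^ 2 * σ 2 = σ 0 * δ ^ 2 := by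
  have h : δ ^ 2 * σ 2 * δ ^ 2 = σ 0 * δ ^ 2 * δ ^ 2 := by
    rw [mul_assoc, ← δ_sq_mul_σ_zero, ← mul_assoc, mul_assoc (σ 0), ← pow_add,
      σ_zero_comm_δ_pow_four]
  exact mul_right_cancel h

/-- The elements `δ` and `σ₁` generate `B₄`, as `δ` conjugates `σ₁` to `σ₂` and `σ₂` to `σ₃`. -/
theorem closure_eq_top : Subgroup.closure {δ, σ 0} = ⊤ := by
  rw [eq_top_iff, ← PresentedGroup.closure_range_of braidRels, Subgroup.closure_le]
  have hδ : δ ∈ Subgroup.closure {δ, σ 0} := Subgroup.subset_closure (by simp)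
  have h0 : σ 0 ∈ Subgroup.closure {δ, σ 0} := Subgroup.subset_closure (by simp)
  have h1 : σ 1 ∈ Subgroup.closure {δ, σ 0} := by
    rw [show σ 1 = δ * σ 0 * δ⁻¹ by rw [δ_mul_σ_zero, mul_inv_cancel_right]]
    exact mul_mem (mul_mem hδ h0) (inv_mem hδ)
  have h2 : σ 2 ∈ Subgroup.closure {δ, σ 0} := by
    rw [show σ 2 = δ * σ 1 * δ⁻¹ by rw [δ_mul_σ_one, mul_inv_cancel_right]]
    exact mul_mem (mul_mem hδ h1) (inv_mem hδ)
  rintro _ ⟨i, rfl⟩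
  fin_cases i
  exacts [h0, h1, h2]

theorem δ_pow_four_comm (g : Braid4) : g * δ ^ 4 = δ ^ 4 * g := by
  have h : Subgroup.closure {δ, σ 0} ≤ Subgroup.centralizer {δ ^ 4} := by
    rw [Subgroup.closure_le]
    rintro x (rfl | rfl) <;> rw [SetLike.mem_coe, Subgroup.mem_centralizer_singleton_iff]
    exacts [(Commute.self_pow δ 4).eq, σ_zero_comm_δ_pow_four]
  rw [closure_eq_top] at h
  exact Subgroup.mem_centralizer_singleton_iff.1 (h (Subgroup.mem_top g))

/-- The exponent sum of a braid. -/
def expSum : Braid4 →* Multiplicative ℤ :=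
  PresentedGroup.toGroup (f := fun _ : Fin 3 => Multiplicative.ofAdd 1) (by
    intro r hr
    simp only [braidRels, Set.mem_insert_iff, Set.mem_singleton_iff] at hr
    rcases hr with rfl | rfl | rfl <;>
      simp only [map_mul, map_inv, FreeGroup.lift_apply_of] <;> decide)

theorem expSum_σ (i : Fin 3) : expSum (σ i) = Multiplicative.ofAdd 1 :=
  PresentedGroup.toGroup.of _

theorem toAdd_expSum_δ : (expSum δ).toAdd = 3 := by
  simp [δ, expSum_σ]

end Braid4

namespace Brady

open Braid4

/-! ### Edges -/

theorem perm_δ : perm δ = Equiv.swap 0 1 * Equiv.swap 1 2 * Equiv.swap 2 3 := by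
  simp only [δ, map_mul, perm_σ]; rfl

theorem perm_δ_pow_four : perm δ ^ 4 = 1 := by
  rw [perm_δ]; decide

theorem perm_σ_zero : perm (σ 0) = Equiv.swap 0 1 := perm_σ 0

theorem perm_σ_two : perm (σ 2) = Equiv.swap 2 3 := perm_σ 2

theorem vert_eq_iff {g h : Braid4} : vert g = vert h ↔ ∃ k : ℤ, h = g * δ ^ k := by
  rw [vert, vert, QuotientGroup.eq, Subgroup.mem_zpowers_iff]
  exact exists_congr fun k => ⟨fun e => by rw [e, mul_inv_cancel_left],
    fun e => by rw [e, inv_mul_cancel_left]⟩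

theorem vert_mul_δ_pow (g : Braid4) (n : ℕ) : vert (g * δ ^ n) = vert g :=
  (vert_eq_iff.2 ⟨n, by rw [zpow_natCast]⟩).symm

/-- The edge from `g⟨δ⟩` to `gσ₁⟨δ⟩`. As `gσᵢ⟨δ⟩ = gδⁱ⁻¹σ₁⟨δ⟩`, every edge is of this form. -/
def edge (g : Braid4) : Sym2 Vertex := s(vert g, vert (g * σ 0))

theorem edge_mul_δ_pow_four (g : Braid4) : edge (g * δ ^ 4) = edge g := by
  rw [edge, edge, vert_mul_δ_pow, mul_assoc, ← δ_pow_four_comm (σ 0), ← mul_assoc, vert_mul_δ_pow]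

theorem edge_mul_δ (g : Braid4) : edge (g * δ) = s(vert g, vert (g * σ 1)) := by
  rw [edge, vert_mul_δ, mul_assoc, δ_mul_σ_zero, ← mul_assoc, vert_mul_δ]

theorem edge_mul_δ_sq (g : Braid4) : edge (g * δ ^ 2) = s(vert g, vert (g * σ 2)) := by
  rw [edge, vert_mul_δ_pow, mul_assoc, δ_sq_mul_σ_zero, ← mul_assoc, vert_mul_δ_pow]

/-- The edges of the Brady complex correspond to the elements of `B₄ / ⟨δ⁴⟩`. An edge cannot be
reversed, because the exponent sum modulo `3` is well defined on vertices and grows by one along it;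
and `σ₁` commutes with `δᵏ` only if `4 ∣ k`, as permutations show. -/
theorem edge_eq_iff {g h : Braid4} : edge g = edge h ↔ ∃ k : ℤ, h = g * (δ ^ 4) ^ k := by
  constructor
  · intro e
    rw [edge, edge, Sym2.eq_iff] at e
    simp only [vert_eq_iff] at e
    rcases e with ⟨⟨k, rfl⟩, m, e⟩ | ⟨⟨k, e⟩, m, e'⟩
    · have hc : δ ^ k * σ 0 = σ 0 * δ ^ m := by
        rw [mul_assoc, mul_assoc] at e; exact mul_left_cancel e
      have hm : m = k := by
        have := congrArg (fun x => (expSum x).toAdd) hc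
        simp [expSum_σ, toAdd_expSum_δ] at this
        omega
      subst hm
      have hp := congrArg perm hc
      simp only [map_mul, map_zpow] at hp
      have h4 : (perm δ) ^ m = (perm δ) ^ (m % 4).toNat := by
        rw [← zpow_natCast, Int.toNat_of_nonneg (Int.emod_nonneg _ (by norm_num))]
        exact zpow_eq_zpow_emod' m perm_δ_pow_four
      rw [h4, perm_σ_zero, perm_δ] at hp
      have hlt : (m % 4).toNat < 4 := by omega
      have h0 : (m % 4).toNat = 0 := by
        generalize (m % 4).toNat = n at hp hlt
        interval_cases n
        · rfl
        all_goals exact absurd hp (by decide)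
      refine ⟨m / 4, ?_⟩
      rw [← zpow_natCast, ← zpow_mul]
      congr 2
      push_cast
      omega
    · exfalso
      rw [e'] at e
      have := congrArg (fun x => (expSum x).toAdd) e
      simp [expSum_σ, toAdd_expSum_δ] at this
      omega
  · rintro ⟨k, rfl⟩
    have hz : ∀ x : Braid4, x * (δ ^ 4) ^ k = (δ ^ 4) ^ k * x := fun x =>
      (Commute.zpow_right (δ_pow_four_comm x) k)
    have hv : ∀ x : Braid4, vert x = vert (x * (δ ^ 4) ^ k) := fun x =>
      vert_eq_iff.2 ⟨4 * k, by rw [zpow_mul]; rfl⟩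
    rw [edge, edge, ← hv, mul_assoc, ← hz, ← mul_assoc, ← hv]

theorem edge_mul_zpow (g : Braid4) (k : ℤ) : edge (g * (δ ^ 4) ^ k) = edge g :=
  (edge_eq_iff.2 ⟨k, rfl⟩).symm

theorem mul_zpow_mul (g h : Braid4) (k : ℤ) : g * (δ ^ 4) ^ k * h = g * h * (δ ^ 4) ^ k := by
  have : (δ ^ 4) ^ k * h = h * (δ ^ 4) ^ k := (Commute.zpow_right (δ_pow_four_comm h) k).symm
  rw [mul_assoc, this, mul_assoc]

theorem perm_eq_of_edge_eq {g h : Braid4} (e : edge g = edge h) : perm g = perm h := by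
  obtain ⟨k, rfl⟩ := edge_eq_iff.1 e
  simp [perm_δ_pow_four]

theorem edge_mul_right_congr {g h : Braid4} (e : edge g = edge h) (x : Braid4) :
    edge (g * x) = edge (h * x) := by
  obtain ⟨k, rfl⟩ := edge_eq_iff.1 e
  rw [mul_zpow_mul, edge_mul_zpow]

theorem mem_edgeSet_iff {e : Sym2 Vertex} : e ∈ skeleton.edgeSet ↔ ∃ g, e = edge g := by
  constructor
  · intro he
    rw [skeleton, SimpleGraph.edgeSet_fromEdgeSet] at he
    obtain ⟨⟨g, i, rfl⟩, -⟩ := he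
    fin_cases i
    exacts [⟨g, rfl⟩, ⟨g * δ, (edge_mul_δ g).symm⟩, ⟨g * δ ^ 2, (edge_mul_δ_sq g).symm⟩]
  · rintro ⟨g, rfl⟩
    exact (SimpleGraph.mem_edgeSet _).2 (adj 0 rfl)

/-- The edges at the vertex `g⟨δ⟩`: the `edge (g * δ ^ j)` lead out of it, the
`edge (g * δ ^ j * (σ 0 * δ)⁻¹)` lead into it. -/
theorem exists_of_vert_mem_edge {g u : Braid4} (h : vert g ∈ edge u) :
    ∃ j : Fin 4, edge u = edge (g * δ ^ (j : ℕ)) ∨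
      edge u = edge (g * δ ^ (j : ℕ) * (σ 0 * δ)⁻¹) := by
  have key : ∀ k : ℤ, ∃ j : Fin 4, edge (g * δ ^ k) = edge (g * δ ^ (j : ℕ)) := fun k => by
    refine ⟨⟨(k % 4).toNat, by omega⟩, ?_⟩
    rw [← edge_mul_zpow (g * δ ^ (k % 4).toNat) (k / 4), mul_assoc, ← zpow_natCast, ← zpow_natCast,
      ← zpow_mul, ← zpow_add, Int.toNat_of_nonneg (Int.emod_nonneg _ (by norm_num))]
    congr 3
    have := Int.emod_add_mul_ediv k 4
    push_cast
    omega
  rw [edge, Sym2.mem_iff] at h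
  rcases h with h | h
  · obtain ⟨k, rfl⟩ := vert_eq_iff.1 h
    obtain ⟨j, hj⟩ := key k
    exact ⟨j, .inl hj⟩
  · obtain ⟨k, hk⟩ := vert_eq_iff.1 h
    obtain ⟨j, hj⟩ := key (k + 1)
    refine ⟨j, .inr ?_⟩
    rw [← edge_mul_right_congr hj, zpow_add, zpow_one, ← mul_assoc, ← hk]
    congr 1
    group

/-! ### Faces -/

theorem triangle_eq (u : Braid4) :
    triangle u = {edge u, edge (u * (σ 0 * δ)), edge (u * (σ 0 * δ) ^ 2)} := by
  have h : (σ 0 * δ) ^ 2 = σ 0 * σ 1 * δ ^ 2 := by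
    rw [pow_two, mul_assoc, ← mul_assoc δ, δ_mul_σ_zero]
    simp only [pow_two, mul_assoc]
  have h2 : edge (u * (σ 0 * δ) ^ 2) = s(vert (u * σ 0 * σ 1), vert u) := by
    rw [h, ← mul_assoc, edge_mul_δ_sq, ← mul_assoc]
    rw [mul_assoc u (σ 0), mul_assoc u, ← δ, vert_mul_δ]
  rw [triangle, h2, ← mul_assoc, edge_mul_δ]
  rfl

theorem lozenge_eq (u : Braid4) :
    lozenge u = {edge u, edge (u * (σ 0 * δ ^ 2)), edge (u * σ 2), edge (u * δ ^ 2)} := by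
  have h : edge (u * σ 2) = s(vert (u * σ 0 * σ 2), vert (u * σ 2)) := by
    rw [edge, mul_assoc, ← σ_comm, ← mul_assoc, Sym2.eq_swap]
  rw [lozenge, h, ← mul_assoc, edge_mul_δ_sq, edge_mul_δ_sq, Sym2.eq_swap (a := vert u)
    (b := vert (u * σ 2))]
  rfl

theorem triangle_congr {u v : Braid4} (h : edge u = edge v) : triangle u = triangle v := by
  rw [triangle_eq, triangle_eq, h, edge_mul_right_congr h, edge_mul_right_congr h]

theorem lozenge_congr {u v : Braid4} (h : edge u = edge v) : lozenge u = lozenge v := by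
  rw [lozenge_eq, lozenge_eq, h, edge_mul_right_congr h, edge_mul_right_congr h,
    edge_mul_right_congr h]

theorem triangle_mul (u : Braid4) : triangle (u * (σ 0 * δ)) = triangle u := by
  rw [triangle_eq, triangle_eq, mul_assoc u, mul_assoc u, ← pow_two, ← pow_succ',
    σ_zero_mul_δ_pow_three, edge_mul_δ_pow_four]
  ext; simp only [Set.mem_insert_iff, Set.mem_singleton_iff]; tauto

theorem lozenge_mul_δ_sq (u : Braid4) : lozenge (u * δ ^ 2) = lozenge u := by
  have h1 : edge (u * δ ^ 2 * (σ 0 * δ ^ 2)) = edge (u * σ 2) := by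
    rw [mul_assoc, ← mul_assoc (δ ^ 2), δ_sq_mul_σ_zero, mul_assoc, ← pow_add, ← mul_assoc,
      edge_mul_δ_pow_four]
  have h2 : edge (u * δ ^ 2 * δ ^ 2) = edge u := by
    rw [mul_assoc, ← pow_add, edge_mul_δ_pow_four]
  have h3 : edge (u * δ ^ 2 * σ 2) = edge (u * (σ 0 * δ ^ 2)) := by
    rw [mul_assoc, δ_sq_mul_σ_two]
  rw [lozenge_eq, lozenge_eq, h1, h2, h3]
  ext; simp only [Set.mem_insert_iff, Set.mem_singleton_iff]; tauto

theorem edge_mem_triangle (u : Braid4) : edge u ∈ triangle u := by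
  rw [triangle_eq]; exact .inl rfl

theorem edge_mem_lozenge (u : Braid4) : edge u ∈ lozenge u := by
  rw [lozenge_eq]; exact .inl rfl

theorem edge_mem_lozenge' (u : Braid4) : edge u ∈ lozenge (u * (σ 2)⁻¹) := by
  rw [lozenge_eq]; exact .inr (.inr (.inl (by rw [inv_mul_cancel_right])))

/-- An edge lies on one triangle and two lozenges. -/
theorem eq_of_edge_mem {u : Braid4} {f : Set (Sym2 Vertex)} (hf : f ∈ complex.faces)
    (hu : edge u ∈ f) : f = triangle u ∨ f = lozenge u ∨ f = lozenge (u * (σ 2)⁻¹) := by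
  obtain ⟨h, rfl | rfl⟩ := hf
  · left
    rw [triangle_eq] at hu
    obtain e | e | e := hu
    · exact (triangle_congr e).symm
    · rw [triangle_congr e, triangle_mul]
    · rw [triangle_congr e, pow_two, ← mul_assoc, triangle_mul, triangle_mul]
  · right
    rw [lozenge_eq] at hu
    obtain e | e | e | e := hu
    · exact .inl (lozenge_congr e).symm
    · right
      rw [lozenge_congr (edge_mul_right_congr e _), ← δ_sq_mul_σ_two, ← mul_assoc,
        mul_inv_cancel_right, lozenge_mul_δ_sq]
    · right
      rw [lozenge_congr (edge_mul_right_congr e _), mul_inv_cancel_right]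
    · left
      rw [lozenge_congr e, lozenge_mul_δ_sq]

/-- The permutations of the braids `x` with `edge (u * x) ∈ triangle u`. -/
def trianglePerms : Finset (Equiv.Perm (Fin 4)) :=
  {1, Equiv.swap 1 2 * Equiv.swap 2 3, (Equiv.swap 1 2 * Equiv.swap 2 3) ^ 2}

/-- The permutations of the braids `x` with `edge (u * x) ∈ lozenge u`. -/
def lozengePerms : Finset (Equiv.Perm (Fin 4)) :=
  {1, Equiv.swap 0 1 * (Equiv.swap 0 1 * Equiv.swap 1 2 * Equiv.swap 2 3) ^ 2,
    Equiv.swap 2 3, (Equiv.swap 0 1 * Equiv.swap 1 2 * Equiv.swap 2 3) ^ 2}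

theorem perm_mem_of_edge_eq {g u v : Braid4} {s : Finset (Equiv.Perm (Fin 4))}
    (h : edge u = edge v) (hs : perm (g⁻¹ * v) ∈ s) : perm (g⁻¹ * u) ∈ s := by
  rwa [map_mul, perm_eq_of_edge_eq h, ← map_mul]

theorem perm_σ_zero_mul_δ : perm (σ 0 * δ) = Equiv.swap 1 2 * Equiv.swap 2 3 := by
  rw [map_mul, perm_δ, perm_σ_zero]; decide

theorem perm_mem_trianglePerms {u v : Braid4} (h : edge v ∈ triangle u) :
    perm (u⁻¹ * v) ∈ trianglePerms := by
  rw [triangle_eq] at h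
  obtain e | e | e := h <;> refine perm_mem_of_edge_eq e ?_ <;>
    simp only [inv_mul_cancel, inv_mul_cancel_left, map_one, map_pow, perm_σ_zero_mul_δ] <;> decide

theorem perm_mem_lozengePerms {u v : Braid4} (h : edge v ∈ lozenge u) :
    perm (u⁻¹ * v) ∈ lozengePerms := by
  rw [lozenge_eq] at h
  obtain e | e | e | e := h <;> refine perm_mem_of_edge_eq e ?_ <;>
    simp only [inv_mul_cancel, inv_mul_cancel_left, map_one, map_mul, map_pow, perm_σ_zero,
      perm_σ_two, perm_δ] <;> decide

/-- As `lozenge u = lozenge (u * δ ^ 2)`, and these are the only coincidences modulo `δ ^ 4`, the sign of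
`u` is determined by `lozenge u`. -/
theorem sign_eq_of_lozenge_eq {u v : Braid4} (h : lozenge u = lozenge v) :
    Equiv.Perm.sign (perm u) = Equiv.Perm.sign (perm v) := by
  have key : ∀ w : Equiv.Perm (Fin 4), w ∈ lozengePerms →
      w * (Equiv.swap 0 1 * (Equiv.swap 0 1 * Equiv.swap 1 2 * Equiv.swap 2 3) ^ 2) ∈ lozengePerms →
      Equiv.Perm.sign w = 1 := by decide
  have h1 : perm (v⁻¹ * u) ∈ lozengePerms := perm_mem_lozengePerms (h ▸ edge_mem_lozenge u)
  have h2 : perm (v⁻¹ * (u * (σ 0 * δ ^ 2))) ∈ lozengePerms := perm_mem_lozengePerms (by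
    rw [← h, lozenge_eq]; exact .inr (.inl rfl))
  rw [← mul_assoc, map_mul, map_mul (x := σ 0), perm_σ_zero, map_pow, perm_δ] at h2
  have := key _ h1 h2
  rw [map_mul, map_mul, map_inv, map_inv, inv_mul_eq_one] at this
  exact this.symm

theorem triangle_ne_lozenge (u v : Braid4) : triangle u ≠ lozenge v := by
  intro h
  have key : ∀ w : Equiv.Perm (Fin 4), w ∈ trianglePerms →
      w * (Equiv.swap 0 1 * (Equiv.swap 0 1 * Equiv.swap 1 2 * Equiv.swap 2 3) ^ 2) ∉
        trianglePerms := by decide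
  have h1 : perm (u⁻¹ * v) ∈ trianglePerms := perm_mem_trianglePerms (h ▸ edge_mem_lozenge v)
  have h2 : perm (u⁻¹ * (v * (σ 0 * δ ^ 2))) ∈ trianglePerms := perm_mem_trianglePerms (by
    rw [h, lozenge_eq]; exact .inr (.inl rfl))
  rw [← mul_assoc, map_mul, map_mul (x := σ 0), perm_σ_zero, map_pow, perm_δ] at h2
  exact key _ h1 h2

theorem sign_perm_δ : Equiv.Perm.sign (perm δ) = -1 := by rw [perm_δ]; decide

theorem sign_perm_σ (i : Fin 3) : Equiv.Perm.sign (perm (σ i)) = -1 := by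
  rw [perm_σ]; fin_cases i <;> decide

theorem sign_perm_mul_inv_σ_two (u : Braid4) :
    Equiv.Perm.sign (perm (u * (σ 2)⁻¹)) = -Equiv.Perm.sign (perm u) := by
  simp [sign_perm_σ]

theorem lozenge_ne_lozenge (u : Braid4) : lozenge u ≠ lozenge (u * (σ 2)⁻¹) := by
  intro h
  have := sign_eq_of_lozenge_eq h
  rw [sign_perm_mul_inv_σ_two] at this
  exact units_ne_neg_self _ this

end Brady

/-! ### Links -/

namespace PolygonalComplex.Subcomplex

variable {V : Type*} {X : PolygonalComplex V} {K : Subcomplex X}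

/-- A property of the edges at `v` which passes from one edge of a face to another holds for all
edges at `v` or for none, if the link of `v` is connected. -/
theorem of_link_connected {v : V} (hv : (K.link v).Connected) {P : Sym2 V → Prop}
    (hP : ∀ e ∈ K.edgesAt v, ∀ e' ∈ K.edgesAt v, ∀ f ∈ K.faces, e ∈ f → e' ∈ f → P e → P e')
    {e e' : Sym2 V} (he : e ∈ K.edgesAt v) (he' : e' ∈ K.edgesAt v) (h : P e) : P e' := by
  obtain ⟨w⟩ := hv.preconnected ⟨e, he⟩ ⟨e', he'⟩
  have key : ∀ (a b : K.edgesAt v) (_ : (K.link v).Walk a b), P a → P b := by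
    intro a b w
    induction w with
    | nil => exact id
    | cons hab _ ih =>
      obtain ⟨-, f, hf, ha, hb⟩ := hab
      exact fun h => ih (hP _ (Subtype.prop _) _ (Subtype.prop _) f hf ha hb h)
  exact key _ _ w h

end PolygonalComplex.Subcomplex

namespace Brady

open Braid4 PolygonalComplex

theorem edge_mul_δ_pow_val_succ (g : Braid4) (j : Fin 4) :
    edge (g * δ ^ ((j + 1 : Fin 4) : ℕ)) = edge (g * δ ^ (j : ℕ) * δ) := by
  rw [mul_assoc, ← pow_succ]
  fin_cases j
  · rfl
  · rfl
  · rfl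
  · exact (congrArg edge (by simp)).trans (edge_mul_δ_pow_four g).symm

theorem lozenge_mul_right_congr {u v : Braid4} (h : edge u = edge v) (x : Braid4) :
    lozenge (u * x) = lozenge (v * x) :=
  lozenge_congr (edge_mul_right_congr h x)

theorem lozenge_mul_inv (u : Braid4) : lozenge (u * (σ 0 * δ)⁻¹) = lozenge (u * δ * (σ 2)⁻¹) := by
  have h : (σ 2)⁻¹ * δ ^ 2 = δ ^ 2 * (σ 0)⁻¹ := by
    rw [inv_mul_eq_iff_eq_mul, ← mul_assoc, ← δ_sq_mul_σ_zero, mul_inv_cancel_right]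
  rw [← lozenge_mul_δ_sq (u * δ * (σ 2)⁻¹), mul_assoc, h,
    ← lozenge_congr (edge_mul_δ_pow_four (u * (σ 0 * δ)⁻¹)), mul_assoc u, δ_pow_four_comm]
  congr 1
  group

theorem mem_edgesAt_iff {K : Subcomplex complex}
    (hK : ∀ e ∈ complex.skeleton.edgeSet, e ∈ K.skeleton.edgeSet) {g : Braid4} {e : Sym2 Vertex} :
    e ∈ K.edgesAt (vert g) ↔ ∃ j : Fin 4, e = edge (g * δ ^ (j : ℕ)) ∨
      e = edge (g * δ ^ (j : ℕ) * (σ 0 * δ)⁻¹) := by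
  constructor
  · rintro ⟨he, hg⟩
    obtain ⟨u, rfl⟩ := mem_edgeSet_iff.1 (K.skeleton.edgeSet_subset he)
    exact exists_of_vert_mem_edge hg
  · rintro ⟨j, rfl | rfl⟩
    · refine ⟨hK _ (mem_edgeSet_iff.2 ⟨_, rfl⟩), ?_⟩
      rw [edge, vert_mul_δ_pow]
      exact Sym2.mem_mk_left _ _
    · refine ⟨hK _ (mem_edgeSet_iff.2 ⟨_, rfl⟩), ?_⟩
      rw [edge, mul_inv_rev, mul_assoc _ (δ⁻¹ * _), inv_mul_cancel_right, ← vert_mul_δ (_ * δ⁻¹),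
        inv_mul_cancel_right, vert_mul_δ_pow]
      exact Sym2.mem_mk_right _ _

/-- The permutation of `δ`. -/
abbrev cyc : Equiv.Perm (Fin 4) := Equiv.swap 0 1 * Equiv.swap 1 2 * Equiv.swap 2 3

/-- The permutation of `σ₁δ`. -/
abbrev tri : Equiv.Perm (Fin 4) := Equiv.swap 1 2 * Equiv.swap 2 3

theorem perm_out (g : Braid4) (n : ℕ) : perm (g⁻¹ * (g * δ ^ n)) = cyc ^ n := by
  rw [inv_mul_cancel_left, map_pow, perm_δ]

theorem perm_in (g : Braid4) (n : ℕ) :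
    perm (g⁻¹ * (g * δ ^ n * (σ 0 * δ)⁻¹)) = cyc ^ n * tri⁻¹ := by
  rw [mul_assoc, inv_mul_cancel_left, map_mul, map_pow, perm_δ, map_inv, perm_σ_zero_mul_δ]

theorem perm_mem_of_mem_lozenge {g u v w : Braid4} (h : edge v ∈ lozenge (u * w)) :
    perm w⁻¹ * (perm (g⁻¹ * u))⁻¹ * perm (g⁻¹ * v) ∈ lozengePerms := by
  have := perm_mem_lozengePerms h
  rw [← map_inv, ← map_mul, ← map_mul]
  convert this using 2
  group

/-- Without its triangles, the link of `g⟨δ⟩` is disconnected: the edges `aⱼ` for even `j` and `bⱼ`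
for odd `j` (notation of `local_faces`) are not joined to the others. Membership in the set `S` of
permutations tells the two classes apart. -/
theorem exists_triangle_mem {K : Subcomplex complex} (hK : K.IsHamiltonianSurface) (g : Braid4) :
    ∃ j : Fin 4, triangle (g * δ ^ (j : ℕ)) ∈ K.faces := by
  by_contra! hT
  have hT' : ∀ j : Fin 4, triangle (g * δ ^ (j : ℕ) * (σ 0 * δ)⁻¹) ∉ K.faces := fun j => by
    rw [← triangle_mul, inv_mul_cancel_right]; exact hT j
  let S : Finset (Equiv.Perm (Fin 4)) := {1, cyc ^ 2, cyc * tri⁻¹, cyc ^ 3 * tri⁻¹}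
  have hstar : ∀ e ∈ K.edgesAt (vert g), ∃ u, e = edge u ∧ triangle u ∉ K.faces ∧
      ∃ j : Fin 4, perm (g⁻¹ * u) = cyc ^ (j : ℕ) ∨ perm (g⁻¹ * u) = cyc ^ (j : ℕ) * tri⁻¹ := by
    intro e he
    obtain ⟨j, rfl | rfl⟩ := (mem_edgesAt_iff hK.every_edge).1 he
    · exact ⟨_, rfl, hT j, j, .inl (perm_out g j)⟩
    · exact ⟨_, rfl, hT' j, j, .inr (perm_in g j)⟩
  have key : ∀ w ∈ ({1, (Equiv.swap 2 3)} : Finset (Equiv.Perm (Fin 4))), ∀ s ∈ S, ∀ j : Fin 4,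
      (w * s⁻¹ * cyc ^ (j : ℕ) ∈ lozengePerms → cyc ^ (j : ℕ) ∈ S) ∧
      (w * s⁻¹ * (cyc ^ (j : ℕ) * tri⁻¹) ∈ lozengePerms → cyc ^ (j : ℕ) * tri⁻¹ ∈ S) := by
    decide
  have h := Subcomplex.of_link_connected
    (hK.isSurface.link_connected (vert g) (hK.every_vertex _))
    (P := fun e => ∃ u, e = edge u ∧ perm (g⁻¹ * u) ∈ S) (e := edge g) (e' := edge (g * δ)) ?_
    ((mem_edgesAt_iff hK.every_edge).2 ⟨0, .inl (by simp)⟩)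
    ((mem_edgesAt_iff hK.every_edge).2 ⟨1, .inl (by simp)⟩)
    ⟨g, rfl, by simp [S]⟩
  · obtain ⟨u, hu, hS⟩ := h
    have := perm_mem_of_edge_eq hu hS
    rw [inv_mul_cancel_left, perm_δ] at this
    exact absurd this (by decide)
  · rintro e he e' he' f hf hef hef' ⟨u', hu', hS⟩
    obtain ⟨u, rfl, hu, -⟩ := hstar e he
    obtain ⟨v, rfl, -, j, hv⟩ := hstar e' he'
    have hS := perm_mem_of_edge_eq hu' hS
    refine ⟨v, rfl, ?_⟩
    have hw : ∃ w ∈ ({1, (Equiv.swap 2 3)} : Finset (Equiv.Perm (Fin 4))),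
        w * (perm (g⁻¹ * u))⁻¹ * perm (g⁻¹ * v) ∈ lozengePerms := by
      obtain rfl | rfl | rfl := eq_of_edge_mem (K.faces_subset hf) hef
      · exact absurd hf hu
      · refine ⟨1, by simp, ?_⟩
        simpa using perm_mem_of_mem_lozenge (g := g) (w := 1) (by simpa using hef')
      · refine ⟨Equiv.swap 2 3, by simp, ?_⟩
        simpa [perm_σ_two] using perm_mem_of_mem_lozenge (g := g) hef'
    obtain ⟨w, hw, hq⟩ := hw
    rcases hv with hv | hv <;> rw [hv] at hq ⊢
    · exact (key w hw _ hS j).1 hq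
    · exact (key w hw _ hS j).2 hq

/-- Without the acute corners of lozenges, the link of `g⟨δ⟩` is disconnected: the edges `aⱼ` and `bⱼ`
for even `j` (notation of `local_faces`) are not joined to the others. -/
theorem exists_lozenge_mem {K : Subcomplex complex} (hK : K.IsHamiltonianSurface) (g : Braid4) :
    ∃ j : Fin 4, lozenge (g * δ ^ (j : ℕ) * (σ 2)⁻¹) ∈ K.faces := by
  by_contra! hL
  have hL' : ∀ j : Fin 4, lozenge (g * δ ^ (j : ℕ) * (σ 0 * δ)⁻¹) ∉ K.faces := fun j => by
    rw [lozenge_mul_inv, lozenge_mul_right_congr (edge_mul_δ_pow_val_succ g j).symm]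
    exact hL (j + 1)
  let S : Finset (Equiv.Perm (Fin 4)) := {1, cyc ^ 2, tri⁻¹, cyc ^ 2 * tri⁻¹}
  have hstar : ∀ e ∈ K.edgesAt (vert g), ∃ u, e = edge u ∧
      ∃ j : Fin 4, perm (g⁻¹ * u) = cyc ^ (j : ℕ) ∧ lozenge (u * (σ 2)⁻¹) ∉ K.faces ∨
        perm (g⁻¹ * u) = cyc ^ (j : ℕ) * tri⁻¹ ∧ lozenge u ∉ K.faces := by
    intro e he
    obtain ⟨j, rfl | rfl⟩ := (mem_edgesAt_iff hK.every_edge).1 he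
    · exact ⟨_, rfl, j, .inl ⟨perm_out g j, hL j⟩⟩
    · exact ⟨_, rfl, j, .inr ⟨perm_in g j, hL' j⟩⟩
  have keyT : ∀ s ∈ S, ∀ j : Fin 4,
      (s⁻¹ * cyc ^ (j : ℕ) ∈ trianglePerms → cyc ^ (j : ℕ) ∈ S) ∧
      (s⁻¹ * (cyc ^ (j : ℕ) * tri⁻¹) ∈ trianglePerms → cyc ^ (j : ℕ) * tri⁻¹ ∈ S) := by
    decide
  have keyOut : ∀ i : Fin 4, cyc ^ (i : ℕ) ∈ S → ∀ j : Fin 4,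
      ((cyc ^ (i : ℕ))⁻¹ * cyc ^ (j : ℕ) ∈ lozengePerms → cyc ^ (j : ℕ) ∈ S) ∧
      ((cyc ^ (i : ℕ))⁻¹ * (cyc ^ (j : ℕ) * tri⁻¹) ∈ lozengePerms →
        cyc ^ (j : ℕ) * tri⁻¹ ∈ S) := by
    decide
  have keyIn : ∀ i : Fin 4, cyc ^ (i : ℕ) * tri⁻¹ ∈ S → ∀ j : Fin 4,
      (Equiv.swap 2 3 * (cyc ^ (i : ℕ) * tri⁻¹)⁻¹ * cyc ^ (j : ℕ) ∈ lozengePerms →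
        cyc ^ (j : ℕ) ∈ S) ∧
      (Equiv.swap 2 3 * (cyc ^ (i : ℕ) * tri⁻¹)⁻¹ * (cyc ^ (j : ℕ) * tri⁻¹) ∈ lozengePerms →
        cyc ^ (j : ℕ) * tri⁻¹ ∈ S) := by
    decide
  have h := Subcomplex.of_link_connected
    (hK.isSurface.link_connected (vert g) (hK.every_vertex _))
    (P := fun e => ∃ u, e = edge u ∧ perm (g⁻¹ * u) ∈ S) (e := edge g) (e' := edge (g * δ)) ?_
    ((mem_edgesAt_iff hK.every_edge).2 ⟨0, .inl (by simp)⟩)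
    ((mem_edgesAt_iff hK.every_edge).2 ⟨1, .inl (by simp)⟩)
    ⟨g, rfl, by simp [S]⟩
  · obtain ⟨u, hu, hS⟩ := h
    have := perm_mem_of_edge_eq hu hS
    rw [inv_mul_cancel_left, perm_δ] at this
    exact absurd this (by decide)
  · rintro e he e' he' f hf hef hef' ⟨u', hu', hS⟩
    obtain ⟨u, rfl, i, hu⟩ := hstar e he
    obtain ⟨v, rfl, j, hv⟩ := hstar e' he'
    have hS := perm_mem_of_edge_eq hu' hS
    refine ⟨v, rfl, ?_⟩
    replace hv := hv.imp And.left And.left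
    obtain rfl | rfl | rfl := eq_of_edge_mem (K.faces_subset hf) hef
    · have hq := perm_mem_trianglePerms hef'
      rw [show u⁻¹ * v = (g⁻¹ * u)⁻¹ * (g⁻¹ * v) by group, map_mul, map_inv] at hq
      rcases hv with hv | hv <;> rw [hv] at hq ⊢
      · exact (keyT _ hS j).1 hq
      · exact (keyT _ hS j).2 hq
    · rcases hu with ⟨hu, -⟩ | ⟨-, hu⟩
      · have hq := perm_mem_of_mem_lozenge (g := g) (w := 1) (by simpa using hef')
        rw [inv_one, map_one, one_mul] at hq
        rw [hu] at hS hq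
        rcases hv with hv | hv <;> rw [hv] at hq ⊢
        · exact (keyOut i hS j).1 hq
        · exact (keyOut i hS j).2 hq
      · exact absurd hf hu
    · rcases hu with ⟨-, hu⟩ | ⟨hu, -⟩
      · exact absurd hf hu
      · have hq := perm_mem_of_mem_lozenge (g := g) hef'
        rw [inv_inv, perm_σ_two] at hq
        rw [hu] at hS hq
        rcases hv with hv | hv <;> rw [hv] at hq ⊢
        · exact (keyIn i hS j).1 hq
        · exact (keyIn i hS j).2 hq

/-! ### Uniqueness -/

theorem two_faces_iff {K : Subcomplex complex} (u : Braid4) :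
    {f | f ∈ K.faces ∧ edge u ∈ f}.encard = 2 ↔
      (triangle u ∈ K.faces ∧ lozenge u ∈ K.faces ∧ lozenge (u * (σ 2)⁻¹) ∉ K.faces) ∨
      (triangle u ∈ K.faces ∧ lozenge u ∉ K.faces ∧ lozenge (u * (σ 2)⁻¹) ∈ K.faces) ∨
      (triangle u ∉ K.faces ∧ lozenge u ∈ K.faces ∧ lozenge (u * (σ 2)⁻¹) ∈ K.faces) := by
  have h : {f | f ∈ K.faces ∧ edge u ∈ f} =
      {triangle u, lozenge u, lozenge (u * (σ 2)⁻¹)} ∩ K.faces := by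
    ext f
    constructor
    · rintro ⟨hf, hu⟩
      exact ⟨eq_of_edge_mem (K.faces_subset hf) hu, hf⟩
    · rintro ⟨rfl | rfl | rfl, hf⟩
      exacts [⟨hf, edge_mem_triangle u⟩, ⟨hf, edge_mem_lozenge u⟩, ⟨hf, edge_mem_lozenge' u⟩]
  have h1 := triangle_ne_lozenge u u
  have h2 := triangle_ne_lozenge u (u * (σ 2)⁻¹)
  have h3 := lozenge_ne_lozenge u
  rw [h]
  by_cases hT : triangle u ∈ K.faces <;> by_cases hL : lozenge u ∈ K.faces <;>
    by_cases hL' : lozenge (u * (σ 2)⁻¹) ∈ K.faces <;>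
    simp [Set.insert_inter_of_mem, Set.insert_inter_of_notMem, Set.singleton_inter_of_mem,
      Set.singleton_inter_of_notMem, hT, hL, hL', h1, h2, h3, Set.encard_insert_of_notMem] <;>
    norm_num

theorem two_of_three {K : Subcomplex complex} (hK : K.IsHamiltonianSurface) (u : Braid4) :
    (triangle u ∈ K.faces ∧ lozenge u ∈ K.faces ∧ lozenge (u * (σ 2)⁻¹) ∉ K.faces) ∨
    (triangle u ∈ K.faces ∧ lozenge u ∉ K.faces ∧ lozenge (u * (σ 2)⁻¹) ∈ K.faces) ∨
    (triangle u ∉ K.faces ∧ lozenge u ∈ K.faces ∧ lozenge (u * (σ 2)⁻¹) ∈ K.faces) :=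
  (two_faces_iff u).1 (hK.isSurface.two_faces _ (hK.every_edge _ (mem_edgeSet_iff.2 ⟨u, rfl⟩)))

theorem δ_sq_mul_inv : δ ^ 2 * (σ 0 * σ 2)⁻¹ = (σ 0 * σ 2)⁻¹ * δ ^ 2 := by
  have h : Commute (δ ^ 2) (σ 0 * σ 2) := by
    rw [commute_iff_eq, ← mul_assoc, δ_sq_mul_σ_zero, mul_assoc, δ_sq_mul_σ_two, ← mul_assoc,
      σ_comm]
  exact h.inv_right.eq

theorem lozenge_mul_inv_mul_inv (u : Braid4) :
    lozenge (u * (σ 0 * δ)⁻¹ * (σ 2)⁻¹) = lozenge (u * σ 0 * σ 1 * (σ 0)⁻¹) := by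
  rw [← lozenge_mul_δ_sq]
  congr 1
  calc u * (σ 0 * δ)⁻¹ * (σ 2)⁻¹ * δ ^ 2 = u * δ⁻¹ * ((σ 0 * σ 2)⁻¹ * δ ^ 2) := by
        rw [σ_comm]; group
    _ = u * δ * (σ 0 * σ 2)⁻¹ := by rw [← δ_sq_mul_inv]; group
    _ = u * σ 0 * σ 1 * (σ 0)⁻¹ := by rw [δ]; group

theorem lozenge_mul_δ_sq_mul_inv_mul_inv (u : Braid4) :
    lozenge (u * δ ^ 2 * (σ 0 * δ)⁻¹ * (σ 2)⁻¹) = lozenge (u * (σ 0 * δ)⁻¹ * (σ 2)⁻¹) := by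
  rw [← lozenge_mul_δ_sq (u * _ * _)]
  congr 1
  calc _ = u * δ⁻¹ * (δ ^ 2 * (σ 0 * σ 2)⁻¹) := by rw [σ_comm]; group
    _ = _ := by rw [δ_sq_mul_inv, σ_comm]; group

/-- Write `aⱼ` for the edge `edge (g * δ ^ j)` and `bⱼ` for `edge (g * δ ^ j * (σ 0 * δ)⁻¹)`. In the
link of `g⟨δ⟩` in the Brady complex, a Möbius ladder on these eight vertices, the triangles give
`aⱼ bⱼ`, the acute corners of lozenges `aⱼ₊₁ bⱼ` and the obtuse ones `aⱼ aⱼ₊₂` and `bⱼ bⱼ₊₂`. The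
missing corners form a perfect matching, which is neither `{aⱼ bⱼ}` nor `{aⱼ₊₁ bⱼ}`. So if `a₂ b₁` is
missing, then so are `a₁ a₃` and `b₀ b₂`; and if one of `a₀ a₂`, `b₀ b₂` and one of `a₁ a₃`, `b₁ b₃`
is present, then `a₀ b₀` is present, and exactly one of `a₀ a₂` and `a₁ a₃` is. -/
theorem local_faces {K : Subcomplex complex} (hK : K.IsHamiltonianSurface) (g : Braid4) :
    (lozenge (g * δ ^ 2 * (σ 2)⁻¹) ∉ K.faces →
      lozenge (g * δ) ∉ K.faces ∧ lozenge (g * (σ 0 * δ)⁻¹ * (σ 2)⁻¹) ∉ K.faces) ∧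
    ((lozenge g ∈ K.faces ∨ lozenge (g * (σ 0 * δ)⁻¹ * (σ 2)⁻¹) ∈ K.faces) →
      (lozenge (g * δ) ∈ K.faces ∨ lozenge (g * δ * (σ 0 * δ)⁻¹ * (σ 2)⁻¹) ∈ K.faces) →
      triangle g ∈ K.faces ∧ (lozenge (g * δ) ∈ K.faces ↔ lozenge g ∉ K.faces)) := by
  have out0 := two_of_three hK g
  have out1 := two_of_three hK (g * δ)
  have out2 := two_of_three hK (g * δ ^ 2)
  have out3 := two_of_three hK (g * δ ^ 3)
  have in0 := two_of_three hK (g * (σ 0 * δ)⁻¹)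
  have in1 := two_of_three hK (g * δ * (σ 0 * δ)⁻¹)
  have in2 := two_of_three hK (g * δ ^ 2 * (σ 0 * δ)⁻¹)
  have in3 := two_of_three hK (g * δ ^ 3 * (σ 0 * δ)⁻¹)
  obtain ⟨i, hi⟩ := exists_triangle_mem hK g
  obtain ⟨j, hj⟩ := exists_lozenge_mem hK g
  have T : ∀ u, triangle (u * (σ 0 * δ)⁻¹) = triangle u := fun u => by
    rw [← triangle_mul, inv_mul_cancel_right]
  have e3 : g * δ ^ 3 = g * δ * δ ^ 2 := by rw [mul_assoc, ← pow_succ']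
  have e4 : lozenge (g * δ ^ 4 * (σ 2)⁻¹) = lozenge (g * (σ 2)⁻¹) :=
    lozenge_mul_right_congr (edge_mul_δ_pow_four g) _
  have s1 : g * δ * δ = g * δ ^ 2 := by rw [mul_assoc, ← pow_two]
  have s2 : g * δ ^ 2 * δ = g * δ ^ 3 := by rw [mul_assoc, ← pow_succ]
  have s3 : g * δ ^ 3 * δ = g * δ ^ 4 := by rw [mul_assoc, ← pow_succ]
  have A2 := lozenge_mul_δ_sq g
  have A3 := lozenge_mul_δ_sq (g * δ)
  have B2 := lozenge_mul_δ_sq_mul_inv_mul_inv g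
  have B3 := lozenge_mul_δ_sq_mul_inv_mul_inv (g * δ)
  rw [← e3] at A3 B3
  rw [T, lozenge_mul_inv] at in0 in1 in2 in3
  rw [A2] at out2
  rw [A3] at out3
  rw [s1] at in1
  rw [B2, s2] at in2
  rw [B3, s3, e4] at in3
  have hi' : triangle g ∈ K.faces ∨ triangle (g * δ) ∈ K.faces ∨ triangle (g * δ ^ 2) ∈ K.faces ∨
      triangle (g * δ ^ 3) ∈ K.faces := by
    fin_cases i <;> simp at hi <;> simp [hi]
  have hj' : lozenge (g * (σ 2)⁻¹) ∈ K.faces ∨ lozenge (g * δ * (σ 2)⁻¹) ∈ K.faces ∨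
      lozenge (g * δ ^ 2 * (σ 2)⁻¹) ∈ K.faces ∨ lozenge (g * δ ^ 3 * (σ 2)⁻¹) ∈ K.faces := by
    fin_cases j <;> simp at hj <;> simp [hj]
  -- What remains is propositional logic in the twelve corners.
  clear hi hj T e3 e4 s1 s2 s3 A2 A3 B2 B3
  grind

/-- The lozenges with the corners `a₀ a₂` and `b₀ b₂` at `g⟨δ⟩` are not both missing: otherwise each of
them has a missing acute corner at another vertex of the triangle `triangle g`, and by `local_faces`
there this would force both lozenges on the third edge of `triangle g` to be missing. -/
theorem lozenge_mem_or {K : Subcomplex complex} (hK : K.IsHamiltonianSurface) (g : Braid4) :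
    lozenge g ∈ K.faces ∨ lozenge (g * (σ 0 * δ)⁻¹ * (σ 2)⁻¹) ∈ K.faces := by
  by_contra! h
  obtain ⟨h1, h2⟩ := h
  have h3 := ((local_faces hK (g * σ 0)).1 (by
    rwa [mul_assoc g, ← δ_sq_mul_σ_two, ← mul_assoc, mul_inv_cancel_right, lozenge_mul_δ_sq])).1
  have h : δ ^ 2 * (σ 2)⁻¹ = (σ 0)⁻¹ * δ ^ 2 := by
    rw [eq_inv_mul_iff_mul_eq, ← mul_assoc, ← δ_sq_mul_σ_two, mul_inv_cancel_right]
  have h4 := ((local_faces hK (g * σ 0 * σ 1)).1 (by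
    rwa [mul_assoc _ (δ ^ 2), h, ← mul_assoc, lozenge_mul_δ_sq, ← lozenge_mul_inv_mul_inv])).2
  have h5 : lozenge (g * σ 0 * δ * (σ 2)⁻¹) ∉ K.faces := by
    rw [lozenge_mul_inv_mul_inv] at h4
    convert h4 using 3
    calc g * σ 0 * δ * (σ 2)⁻¹ = g * σ 0 * (σ 0 * σ 1 * σ 0) * (σ 0)⁻¹ := by rw [δ]; group
      _ = _ := by rw [σ_braid_zero]; simp only [mul_assoc]
  have := two_of_three hK (g * σ 0 * δ)
  tauto

theorem triangle_mem {K : Subcomplex complex} (hK : K.IsHamiltonianSurface) (g : Braid4) :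
    triangle g ∈ K.faces :=
  ((local_faces hK g).2 (lozenge_mem_or hK g) (lozenge_mem_or hK (g * δ))).1

theorem lozenge_mul_δ_mem_iff {K : Subcomplex complex} (hK : K.IsHamiltonianSurface)
    (g : Braid4) : lozenge (g * δ) ∈ K.faces ↔ lozenge g ∉ K.faces :=
  ((local_faces hK g).2 (lozenge_mem_or hK g) (lozenge_mem_or hK (g * δ))).2

theorem lozenge_mul_σ_zero_mem_iff {K : Subcomplex complex} (hK : K.IsHamiltonianSurface)
    (g : Braid4) : lozenge (g * σ 0) ∈ K.faces ↔ lozenge g ∉ K.faces := by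
  have h := two_of_three hK (g * σ 0 * δ ^ 2)
  rw [mul_assoc g, ← δ_sq_mul_σ_two, ← mul_assoc, mul_inv_cancel_right, lozenge_mul_δ_sq, mul_assoc,
    δ_sq_mul_σ_two, ← mul_assoc, lozenge_mul_δ_sq] at h
  have := triangle_mem hK (g * σ 0 * δ ^ 2)
  rw [mul_assoc g] at this
  rw [mul_assoc g] at h
  tauto

/-- Whether a lozenge is present changes with each generator, so it depends on the sign of `g` only. -/
theorem lozenge_mem_iff {K : Subcomplex complex} (hK : K.IsHamiltonianSurface) (g : Braid4) :
    lozenge g ∈ K.faces ↔ (Equiv.Perm.sign (perm g) = 1 ↔ lozenge 1 ∈ K.faces) := by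
  let H : Subgroup Braid4 :=
    { carrier := {h | ∀ g, lozenge (g * h) ∈ K.faces ↔
        (Equiv.Perm.sign (perm h) = 1 ↔ lozenge g ∈ K.faces)}
      one_mem' := fun g => by simp
      mul_mem' := fun {a b} ha hb g => by
        rw [← mul_assoc, hb, ha, map_mul, map_mul]
        rcases Int.units_eq_one_or (Equiv.Perm.sign (perm a)) with h | h <;>
          rcases Int.units_eq_one_or (Equiv.Perm.sign (perm b)) with h' | h' <;> simp [h, h']
      inv_mem' := fun {a} ha g => by
        have := ha (g * a⁻¹)
        rw [inv_mul_cancel_right] at this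
        rw [this]
        rcases Int.units_eq_one_or (Equiv.Perm.sign (perm a)) with h | h <;> simp [h] }
  have hH : H = ⊤ := by
    rw [eq_top_iff, ← closure_eq_top, Subgroup.closure_le]
    rintro x (rfl | rfl) g
    · rw [lozenge_mul_δ_mem_iff hK, sign_perm_δ]; simp
    · rw [lozenge_mul_σ_zero_mem_iff hK, sign_perm_σ]; simp
  have := (hH ▸ Subgroup.mem_top g : g ∈ H) 1
  rwa [one_mul] at this

/-! ### Existence -/

/-- The subcomplex with all vertices, edges and triangles, and with the lozenges `lozenge g` for
which `g` has sign `ε`. -/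
def surface (ε : ℤˣ) : Subcomplex complex where
  skeleton := ⊤
  faces := {f | ∃ g, f = triangle g ∨ f = lozenge g ∧ Equiv.Perm.sign (perm g) = ε}
  faces_subset := fun _ ⟨g, h⟩ => ⟨g, h.imp_right And.left⟩
  boundary_subset := by
    rintro f ⟨g, h⟩ e he
    obtain ⟨v, c, -, hc⟩ := complex.boundary_isCycle f ⟨g, h.imp_right And.left⟩
    rw [SimpleGraph.Subgraph.edgeSet_top]
    rw [hc] at he
    exact c.edges_subset_edgeSet he

variable {ε : ℤˣ}

theorem triangle_mem_surface (g : Braid4) : triangle g ∈ (surface ε).faces := ⟨g, .inl rfl⟩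

theorem lozenge_mem_surface_iff {g : Braid4} :
    lozenge g ∈ (surface ε).faces ↔ Equiv.Perm.sign (perm g) = ε := by
  constructor
  · rintro ⟨h, e | ⟨e, rfl⟩⟩
    · exact absurd e.symm (triangle_ne_lozenge _ _)
    · exact sign_eq_of_lozenge_eq e
  · exact fun h => ⟨g, .inr ⟨rfl, h⟩⟩

theorem mem_edgeSet_surface {e : Sym2 Vertex} (he : e ∈ complex.skeleton.edgeSet) :
    e ∈ (surface ε).skeleton.edgeSet := by
  rw [surface, SimpleGraph.Subgraph.edgeSet_top]; exact he

theorem skeleton_connected : skeleton.Connected := by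
  have : Nonempty Vertex := ⟨vert 1⟩
  refine ⟨fun v w => ?_⟩
  let H : Subgroup Braid4 :=
    { carrier := {h | ∀ g, skeleton.Reachable (vert g) (vert (g * h))}
      one_mem' := fun g => by rw [mul_one]
      mul_mem' := fun {a b} ha hb g => by
        rw [← mul_assoc]; exact (ha g).trans (hb (g * a))
      inv_mem' := fun {a} ha g => by
        have := ha (g * a⁻¹)
        rw [inv_mul_cancel_right] at this
        exact this.symm }
  have hH : H = ⊤ := by
    rw [eq_top_iff, ← closure_eq_top, Subgroup.closure_le]
    rintro x (rfl | rfl) g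
    · rw [vert_mul_δ]
    · exact (adj 0 rfl).reachable
  obtain ⟨g, rfl⟩ := QuotientGroup.mk_surjective v
  obtain ⟨h, rfl⟩ := QuotientGroup.mk_surjective w
  have := (hH ▸ Subgroup.mem_top (g⁻¹ * h) : g⁻¹ * h ∈ H) g
  rwa [mul_inv_cancel_left] at this

/-- At the vertex `g⟨δ⟩`, where `g` may be chosen of sign `ε`, the link of `surface ε` is a
Hamiltonian cycle of the Möbius ladder. With `aⱼ` and `bⱼ` for the edges leading out of and into
the vertex it is `a₀ b₀ a₁ b₁ b₃ a₃ b₂ a₂`. -/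
theorem surface_link_connected (v : Vertex) : ((surface ε).link v).Connected := by
  obtain ⟨g, rfl, hg⟩ : ∃ g, vert g = v ∧ Equiv.Perm.sign (perm g) = ε := by
    obtain ⟨g, rfl⟩ := QuotientGroup.mk_surjective v
    rcases eq_or_ne (Equiv.Perm.sign (perm g)) ε with h | h
    · exact ⟨g, rfl, h⟩
    · refine ⟨g * δ, vert_mul_δ g, ?_⟩
      rw [map_mul, map_mul, sign_perm_δ, mul_neg_one]
      exact (Int.units_ne_iff_eq_neg.1 h.symm).symm
  have hmem : ∀ {e : Sym2 Vertex}, e ∈ (surface ε).edgesAt (vert g) ↔ _ :=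
    mem_edgesAt_iff fun _ => mem_edgeSet_surface
  let a : Fin 4 → (surface ε).edgesAt (vert g) := fun j =>
    ⟨edge (g * δ ^ (j : ℕ)), hmem.2 ⟨j, .inl rfl⟩⟩
  let b : Fin 4 → (surface ε).edgesAt (vert g) := fun j =>
    ⟨edge (g * δ ^ (j : ℕ) * (σ 0 * δ)⁻¹), hmem.2 ⟨j, .inr rfl⟩⟩
  have reach : ∀ {e e' : (surface ε).edgesAt (vert g)} (f), f ∈ (surface ε).faces →
      (e : Sym2 Vertex) ∈ f → (e' : Sym2 Vertex) ∈ f →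
        ((surface ε).link (vert g)).Reachable e e' := by
    intro e e' f hf he he'
    by_cases h : e = e'
    · rw [h]
    · exact SimpleGraph.Adj.reachable ⟨h, f, hf, he, he'⟩
  have hab : ∀ j, ((surface ε).link (vert g)).Reachable (a j) (b j) := fun j =>
    reach _ (triangle_mem_surface _) (edge_mem_triangle _) (by
      rw [← inv_mul_cancel_right (g * δ ^ (j : ℕ)) (σ 0 * δ), triangle_mul]
      exact edge_mem_triangle _)
  have hba : ∀ j : Fin 4, (j = 0 ∨ j = 2) →
      ((surface ε).link (vert g)).Reachable (b j) (a (j + 1)) := fun j hj =>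
    reach (lozenge (g * δ ^ (j : ℕ) * δ * (σ 2)⁻¹))
      (lozenge_mem_surface_iff.2 (by
        rw [sign_perm_mul_inv_σ_two]
        rcases hj with rfl | rfl <;> simp [sign_perm_δ, hg]))
      (by rw [← lozenge_mul_inv]; exact edge_mem_lozenge _)
      (by
        change edge (g * δ ^ ((j + 1 : Fin 4) : ℕ)) ∈ _
        rw [edge_mul_δ_pow_val_succ]; exact edge_mem_lozenge' _)
  have haa : ((surface ε).link (vert g)).Reachable (a 0) (a 2) :=
    reach (lozenge g) (lozenge_mem_surface_iff.2 hg)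
      (by
        change edge (g * δ ^ 0) ∈ _
        rw [pow_zero, mul_one]; exact edge_mem_lozenge _)
      (by
        change edge (g * δ ^ 2) ∈ _
        rw [← lozenge_mul_δ_sq]; exact edge_mem_lozenge _)
  have h1 := (hab 0).trans (hba 0 (.inl rfl))
  have h3 := (haa.trans (hab 2)).trans (hba 2 (.inr rfl))
  have ha : ∀ j, ((surface ε).link (vert g)).Reachable (a 0) (a j) := by
    intro j
    fin_cases j
    exacts [.refl _, h1, haa, h3]
  have hall : ∀ e, ((surface ε).link (vert g)).Reachable (a 0) e := by
    rintro ⟨e, he⟩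
    obtain ⟨j, rfl | rfl⟩ := hmem.1 he
    exacts [ha j, (ha j).trans (hab j)]
  have : Nonempty ((surface ε).edgesAt (vert g)) := ⟨a 0⟩
  exact ⟨fun e e' => (hall e).symm.trans (hall e')⟩

theorem surface_isHamiltonianSurface (ε : ℤˣ) : (surface ε).IsHamiltonianSurface where
  isSurface :=
    { connected := ⟨SimpleGraph.Subgraph.topIso.connected_iff.2 skeleton_connected⟩
      two_faces := by
        intro e he
        obtain ⟨u, rfl⟩ := mem_edgeSet_iff.1 ((surface ε).skeleton.edgeSet_subset he)
        rw [two_faces_iff, lozenge_mem_surface_iff, lozenge_mem_surface_iff,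
          sign_perm_mul_inv_σ_two]
        simp only [triangle_mem_surface, true_and, not_true, false_and, or_false]
        rcases Int.units_eq_one_or ε with rfl | rfl <;>
          rcases Int.units_eq_one_or (Equiv.Perm.sign (perm u)) with h | h <;> rw [h] <;> decide
      link_finite := by
        intro v _
        obtain ⟨g, rfl⟩ := QuotientGroup.mk_surjective v
        refine ((Set.finite_range fun j : Fin 4 => edge (g * δ ^ (j : ℕ))).union
          (Set.finite_range fun j : Fin 4 => edge (g * δ ^ (j : ℕ) * (σ 0 * δ)⁻¹))).subset ?_
        intro e he
        obtain ⟨j, rfl | rfl⟩ := (mem_edgesAt_iff fun _ => mem_edgeSet_surface).1 he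
        exacts [.inl ⟨j, rfl⟩, .inr ⟨j, rfl⟩]
      link_connected := fun v _ => surface_link_connected v }
  every_vertex := fun _ => trivial
  every_edge := fun _ => mem_edgeSet_surface

theorem surface_ne : surface 1 ≠ surface (-1) := by
  intro h
  have h1 : lozenge 1 ∈ (surface 1).faces := lozenge_mem_surface_iff.2 (by simp)
  rw [h, lozenge_mem_surface_iff, map_one, map_one] at h1
  exact absurd h1 (by decide)

theorem eq_surface {K : Subcomplex complex} (hK : K.IsHamiltonianSurface)
    (h : ∀ g, lozenge g ∈ K.faces ↔ Equiv.Perm.sign (perm g) = ε) : K = surface ε := by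
  have hs : K.skeleton = (surface ε).skeleton := by
    refine SimpleGraph.Subgraph.ext (Set.eq_univ_of_forall hK.every_vertex) ?_
    ext v w
    exact ⟨fun h => h.adj_sub, fun h => hK.every_edge s(v, w) h⟩
  have hf : K.faces = (surface ε).faces := by
    ext f
    constructor
    · intro hf
      obtain ⟨g, rfl | rfl⟩ := K.faces_subset hf
      exacts [⟨g, .inl rfl⟩, ⟨g, .inr ⟨rfl, (h g).1 hf⟩⟩]
    · rintro ⟨g, rfl | ⟨rfl, hg⟩⟩
      exacts [triangle_mem hK g, (h g).2 hg]
  cases K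
  cases hs
  cases hf
  rfl

end Brady

theorem theorem1p3 :
    {K : PolygonalComplex.Subcomplex Brady.complex | K.IsHamiltonianSurface}.encard = 2 := by
  have h : {K : PolygonalComplex.Subcomplex Brady.complex | K.IsHamiltonianSurface} =
      {Brady.surface 1, Brady.surface (-1)} := by
    ext K
    constructor
    · intro hK
      by_cases h1 : Brady.lozenge 1 ∈ K.faces
      · refine .inl (Brady.eq_surface hK fun g => ?_)
        rw [Brady.lozenge_mem_iff hK]
        simp [h1]
      · refine .inr (Brady.eq_surface hK fun g => ?_)
        rw [Brady.lozenge_mem_iff hK, iff_false_right h1]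
        exact Int.units_ne_iff_eq_neg
    · rintro (rfl | rfl) <;> exact Brady.surface_isHamiltonianSurface _
  rw [h, Set.encard_pair Brady.surface_ne]
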